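/- Let $X$ be a measurable space, let $D_1,\dots,D_n$ ($n\ge 1$) be unknown probability distributions on $X\times\{0,1\}$, let $H$ be a nonempty class of measurable classifiers $X\to\{0,1\}$ of VC dimension $d<\infty$, and let $\ell(h,(x,y))=g(h(x),y)$ be a loss with $g:\{0,1\}^2\to[0,1]$. Write $R_D(h)=\mathbb E_{z\sim D}[\ell(h,z)]$, $R_D(q)=\mathbb E_{f\sim q}[R_D(f)]$ for a randomized classifier $q$ (a discrete probability distribution over classifiers), and $\mathrm{OPT}=\inf_{h\in H}\max_{i}R_{D_i}(h)$. A (randomized) classifier $q$ is $\varepsilon$-optimal if $\max_i R_{D_i}(q)\le \mathrm{OPT}+\varepsilon$. A finite set $N$ of measurable classifiers is an $r$-net of $H$ for $D_1,\dots,D_n$ if for every $h\in H$ there is $f\in N$ with $\Pr_{(x,y)\sim D_i}[h(x)\ne f(x)]\le r$ for all $i=1,\dots,n$. A learning algorithm accesses the $D_i$ only through example oracles: it adaptively, and possibly at random, chooses an index $i$ and receives an independent sample from $D_i$; its sample complexity is the total number of oracle calls. For every real polynomial $P$ in four variables and every constant $\gamma\in(0,1)$ there is a constant $C>0$, depending only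 on $P$ and $\gamma$, such that the following holds for all $X$, $n\ge1$, $d\ge 0$, $\varepsilon,\delta\in(0,1)$, and $H$, $g$ as above. Let $N$ be a given finite set of measurable classifiers with $$|N|\le P\big((n/\varepsilon)^d,\ \varepsilon,\ d,\ n\big).$$ Then there is a learning algorithm, which may depend on $X,n,d,\varepsilon,\delta,H,g,N$ but not on the distributions, that makes at most $$C\,\varepsilon^{-2}\big(d\log(dn/\varepsilon)+n\log(n/\delta)\big)$$ oracle calls (where $d\log(dn/\varepsilon)$ is read as $0$ if $d=0$), always returns a randomized classifier supported on $H\cup N$, and, for all distributions $D_1,\dots,D_n$ for which $N$ is a $\gamma\varepsilon$-net of $H$, returns with probability at least $1-\delta$ an $\varepsilon$-optimal solution. -/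

import Mathlib

open MeasureTheory

noncomputable section

namespace CollabLearning

universe u

/-- A data point: a feature together with a binary label. -/
abbrev Datum (X : Type u) : Type u := X × Bool

/-- The class `H` of binary classifiers shatters the finite set `S`: every labelling of `S`
is realized by some member of `H`. -/
def Shatters {X : Type u} (H : Set (X → Bool)) (S : Finset X) : Prop :=
  ∀ y : X → Bool, ∃ h ∈ H, ∀ x ∈ S, h x = y x

/-- The VC dimension: the supremum of the sizes of the shattered finite sets
(`⊤` if these are unbounded). -/
def vcDim {X : Type u} (H : Set (X → Bool)) : ℕ∞ :=
  ⨆ (S : Finset X) (_ : Shatters H S), (S.card : ℕ∞)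

variable {X : Type u} [MeasurableSpace X]

/-- The risk of a deterministic classifier `h` on `D`, for the loss `(h, (x, y)) ↦ g (h x) y`. -/
def risk (g : Bool → Bool → ℝ) (D : Measure (Datum X)) (h : X → Bool) : ℝ :=
  ∫ z, g (h z.1) z.2 ∂D

/-- The risk of a randomized classifier: the expectation of `risk g D f` over `f ∼ q`. -/
def randRisk (g : Bool → Bool → ℝ) (D : Measure (Datum X)) (q : PMF (X → Bool)) : ℝ :=
  ∑' f : X → Bool, (q f).toReal * risk g D f

/-- The benchmark `OPT`: the best worst-case risk over the class `H`. -/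
def opt (g : Bool → Bool → ℝ) {n : ℕ} (D : Fin n → Measure (Datum X))
    (H : Set (X → Bool)) : ℝ :=
  ⨅ h : H, ⨆ i, risk g (D i) h

/-- The randomized classifier `q` is an `ε`-optimal solution of the problem `(H, D)`. -/
def IsEpsOptimal (g : Bool → Bool → ℝ) {n : ℕ} (D : Fin n → Measure (Datum X))
    (H : Set (X → Bool)) (ε : ℝ) (q : PMF (X → Bool)) : Prop :=
  ⨆ i, randRisk g (D i) q ≤ opt g D H + ε

/-- `N` is an `r`-net of `H` for the distributions `D i`, simultaneously: each `h ∈ H` has a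
representative in `N` that disagrees with `h` with probability at most `r` under every `D i`. -/
def IsNet {n : ℕ} (D : Fin n → Measure (Datum X)) (H : Set (X → Bool)) (r : ℝ)
    (N : Finset (X → Bool)) : Prop :=
  ∀ h ∈ H, ∃ f ∈ N, ∀ i, D i {z | h z.1 ≠ f z.1} ≤ ENNReal.ofReal r

/-- The record of the first `t` example-oracle calls: for each call, the index of the oracle that
was called and the data point that it returned. -/
abbrev History (n : ℕ) (X : Type u) (t : ℕ) : Type u := Fin t → Fin n × Datum X

/-- A (randomized) learning algorithm that samples on demand from `n` example oracles. In round `t`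
it draws, from a law that may depend on everything recorded so far, the index of the oracle that it
calls next. After `calls` calls it returns a randomized classifier, computed from the record. The
distributions behind the oracles do not enter: they are accessible through the calls only. -/
structure Learner (n : ℕ) (X : Type u) [MeasurableSpace X] where
  /-- the total number of calls to the example oracles -/
  calls : ℕ
  /-- the law of the index of the next oracle to be called -/
  query : (t : ℕ) → History n X t → PMF (Fin n)
  measurable_query : ∀ t i, Measurable fun w : History n X t => query t w i
  /-- the returned randomized classifier -/
  output : History n X calls → PMF (X → Bool)
  measurable_output : ∀ f, Measurable fun w : History n X calls => output w f

/-- The law of the record of the first `t` calls when the `i`-th oracle returns independent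
samples from `D i`. -/
def Learner.law {n : ℕ} (A : Learner n X) (D : Fin n → Measure (Datum X)) :
    (t : ℕ) → Measure (History n X t)
  | 0 => Measure.dirac Fin.elim0
  | t + 1 => (A.law D t).bind fun w =>
      ∑ i, A.query t w i •
        (D i).map fun z => (Fin.snoc (α := fun _ => Fin n × Datum X) w (i, z) : History n X (t + 1))

end CollabLearning

end

open MeasureTheory

noncomputable section

namespace CollabLearning

universe u

/-! ### Elementary inequalities -/

/-! Finding one mixture over the finite set `N` that is good for all `D i` is treated as a zero-sum
game. Each round draws one example. The learner runs exponential weights on `N`, using the loss of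
every member on that example. An adversary runs exponential weights on the `n` oracles, but observes
only the oracle it called; its loss is one minus the learner's. The learner's regret compares its
total loss with that of a net element whose risk is at most `opt + γε` under every `D i`. The
adversary's regret compares the total risk under each `D j` with the learner's total loss. The
averaged weights therefore have risk at most `opt + γε + κ`, where `κ = (1 - γ)ε`, after about `κ⁻²
(log |N| + n log (3n/δ))` rounds. The regret bounds hold on every record (`GameInvariant`).
Probability enters only through three exponential supermartingales: `estimate_concentration`,
`estimate_sum_concentration` and `comparator_concentration`. `mixture_loss_le` adds everything up,
giving `gameLearner_guarantee`. The polynomial bound gives `log |N| ≤ const + k d log (dn/ε)`.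
Additive constants must be absorbed into `complexity`, which tends to `0` for `n = d = 1` and `ε, δ
→ 1`. If `ε ≥ 1 - (1 - γ)/|N|`, the uniform mixture on `N` needs no samples; otherwise
`complexity_lower_bound` keeps `complexity` away from `0`. For `d = 0` the class is a single
classifier. -/

lemma exp_neg_le_quadratic {x : ℝ} (hx : 0 ≤ x) : Real.exp (-x) ≤ 1 - x + x ^ 2 / 2 := by
  have h1 := Real.quadratic_le_exp_of_nonneg hx
  rw [Real.exp_neg, inv_le_comm₀ (Real.exp_pos x) (by nlinarith [sq_nonneg (x - 1)])]
  refine le_trans ?_ h1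
  rw [inv_le_iff_one_le_mul₀ (by nlinarith [sq_nonneg (x - 1)])]
  -- `(1 + x + x²/2)(1 - x + x²/2) = 1 + x⁴/4`.
  nlinarith [sq_nonneg (x ^ 2)]

/-- From `log (1 + x) ≥ 2x/(x + 2)` at `x = βc/w`, then `c ≤ 1`. Shifting the denominator by `β/2`
removes the second-order term, which would blow up for small `w`. -/
lemma exp_implicit_exploration_le {β c w : ℝ} (hβ : 0 < β) (hc0 : 0 ≤ c) (hc1 : c ≤ 1)
    (hw : 0 < w) : Real.exp (β * (c / (w + β / 2))) ≤ 1 + β * (c / w) := by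
  have hx : 0 ≤ β * (c / w) := by positivity
  rw [← Real.le_log_iff_exp_le (by positivity)]
  refine le_trans ?_ (Real.le_log_one_add_of_nonneg hx)
  have h : 2 * (β * (c / w)) / (β * (c / w) + 2) = β * (c / (w + β * c / 2)) := by
    field_simp
    ring
  rw [h]
  gcongr
  nlinarith

/-! ### Exponential weights -/

section Softmax

variable {κ : Type*} [Fintype κ]

/-- The exponential weights at learning rate `a` for the cumulative losses `L`. -/
def expWeights (a : ℝ) (L : κ → ℝ) (k : κ) : ℝ :=
  Real.exp (-a * L k) / ∑ k', Real.exp (-a * L k')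

lemma sum_exp_pos [Nonempty κ] (a : ℝ) (L : κ → ℝ) : 0 < ∑ k, Real.exp (-a * L k) :=
  Finset.sum_pos (fun _ _ => Real.exp_pos _) Finset.univ_nonempty

lemma expWeights_pos [Nonempty κ] (a : ℝ) (L : κ → ℝ) (k : κ) : 0 < expWeights a L k :=
  div_pos (Real.exp_pos _) (sum_exp_pos a L)

lemma sum_expWeights [Nonempty κ] (a : ℝ) (L : κ → ℝ) : ∑ k, expWeights a L k = 1 := by
  simp only [expWeights, ← Finset.sum_div]
  exact div_self (sum_exp_pos a L).ne'

lemma measurable_expWeights (a : ℝ) (k : κ) : Measurable fun L : κ → ℝ => expWeights a L k := by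
  unfold expWeights
  fun_prop

/-- Each factor is expanded to second order and the total is recombined by `1 + y ≤ exp y`. The
increments `l` need no upper bound, which matters because loss estimates can be as large as `2/β`.
-/
lemma sum_exp_add_le [Nonempty κ] (a : ℝ) (ha : 0 ≤ a) (L l : κ → ℝ) (hl : ∀ k, 0 ≤ l k) :
    ∑ k, Real.exp (-a * (L k + l k)) ≤ (∑ k, Real.exp (-a * L k)) *
      Real.exp (-a * ∑ k, expWeights a L k * l k +
        a ^ 2 / 2 * ∑ k, expWeights a L k * l k ^ 2) := by
  have hW := sum_exp_pos a L
  have h1 : ∀ k, Real.exp (-a * (L k + l k)) ≤ (∑ k, Real.exp (-a * L k)) *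
      (expWeights a L k - a * (expWeights a L k * l k)
        + a ^ 2 / 2 * (expWeights a L k * l k ^ 2)) := by
    intro k
    have h2 := exp_neg_le_quadratic (mul_nonneg ha (hl k))
    have h3 : (∑ k, Real.exp (-a * L k)) * expWeights a L k = Real.exp (-a * L k) :=
      mul_div_cancel₀ _ hW.ne'
    calc Real.exp (-a * (L k + l k)) = Real.exp (-a * L k) * Real.exp (-(a * l k)) := by
          rw [← Real.exp_add]; ring_nf
      _ ≤ Real.exp (-a * L k) * (1 - a * l k + (a * l k) ^ 2 / 2) := by gcongr
      _ = _ := by rw [← h3]; ring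
  calc _ ≤ ∑ k, (∑ k, Real.exp (-a * L k)) * (expWeights a L k - a * (expWeights a L k * l k)
        + a ^ 2 / 2 * (expWeights a L k * l k ^ 2)) := Finset.sum_le_sum fun k _ => h1 k
    _ = (∑ k, Real.exp (-a * L k)) * (-a * ∑ k, expWeights a L k * l k +
        a ^ 2 / 2 * ∑ k, expWeights a L k * l k ^ 2 + 1) := by
        rw [← Finset.mul_sum, Finset.sum_add_distrib, Finset.sum_sub_distrib, sum_expWeights,
          ← Finset.mul_sum, ← Finset.mul_sum]
        ring
    _ ≤ _ := by
        gcongr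
        exact Real.add_one_le_exp _

/-- The probability mass function with prescribed real weights. -/
def pmfOfReal (p : κ → ℝ) (h0 : ∀ k, 0 ≤ p k) (h1 : ∑ k, p k = 1) : PMF κ :=
  PMF.ofFintype (fun k => ENNReal.ofReal (p k)) (by
    rw [← ENNReal.ofReal_sum_of_nonneg fun k _ => h0 k, h1, ENNReal.ofReal_one])

end Softmax

/-! ### Algorithms driven by a state -/

section Run

variable {X : Type u} {n : ℕ} {S : Type*}

/-- The state reached after reading a record, when every entry updates the state by `upd`. -/
def run (upd : S → Fin n × Datum X → S) (s₀ : S) : (t : ℕ) → History n X t → S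
  | 0, _ => s₀
  | t + 1, w => upd (run upd s₀ t (Fin.init w)) (w (Fin.last t))

@[simp]
lemma run_succ_snoc (upd : S → Fin n × Datum X → S) (s₀ : S) (t : ℕ) (w : History n X t)
    (x : Fin n × Datum X) :
    run upd s₀ (t + 1) (Fin.snoc (α := fun _ => Fin n × Datum X) w x) =
      upd (run upd s₀ t w) x := by
  simp [run]

lemma run_induction (upd : S → Fin n × Datum X → S) (s₀ : S) (I : ℕ → S → Prop) (h0 : I 0 s₀)
    (hs : ∀ t s x, I t s → I (t + 1) (upd s x)) (t : ℕ) (w : History n X t) :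
    I t (run upd s₀ t w) := by
  induction t with
  | zero => exact h0
  | succ t ih => exact hs _ _ _ (ih _)

variable [MeasurableSpace X] [MeasurableSpace S]

lemma measurable_run {upd : S → Fin n × Datum X → S} (hu : Measurable (Function.uncurry upd))
    (s₀ : S) (t : ℕ) : Measurable (run upd s₀ t) := by
  induction t with
  | zero => exact measurable_const
  | succ t ih =>
    have h1 : Measurable fun w : History n X (t + 1) => (Fin.init w : History n X t) :=
      measurable_pi_lambda _ fun i => measurable_pi_apply _
    have h2 : Measurable fun w : History n X (t + 1) => w (Fin.last t) := measurable_pi_apply _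
    exact hu.comp ((ih.comp h1).prodMk h2)

lemma measurable_snoc (t : ℕ) (i : Fin n) :
    Measurable fun p : History n X t × Datum X =>
      (Fin.snoc (α := fun _ => Fin n × Datum X) p.1 (i, p.2) : History n X (t + 1)) := by
  refine measurable_pi_lambda _ fun j => ?_
  refine Fin.lastCases ?_ (fun j => ?_) j
  · simp only [Fin.snoc_last]
    fun_prop
  · simp only [Fin.snoc_castSucc]
    exact (measurable_pi_apply j).comp measurable_fst

lemma Learner.lintegral_law_succ (A : Learner n X) (D : Fin n → Measure (Datum X))
    [∀ i, IsProbabilityMeasure (D i)] (t : ℕ) {f : History n X (t + 1) → ENNReal}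
    (hf : Measurable f) :
    ∫⁻ w, f w ∂A.law D (t + 1) = ∫⁻ w, ∑ i, A.query t w i *
      ∫⁻ z, f (Fin.snoc (α := fun _ => Fin n × Datum X) w (i, z)) ∂D i ∂A.law D t := by
  have hsnoc : ∀ (w : History n X t) (i : Fin n), Measurable fun z : Datum X =>
      (Fin.snoc (α := fun _ => Fin n × Datum X) w (i, z) : History n X (t + 1)) :=
    fun w i => (measurable_snoc t i).comp (measurable_const.prodMk measurable_id)
  have hk : Measurable fun w : History n X t => ∑ i, A.query t w i •
      (D i).map fun z => (Fin.snoc (α := fun _ => Fin n × Datum X) w (i, z) :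
        History n X (t + 1)) := by
    refine Measure.measurable_of_measurable_coe _ fun s hs => ?_
    simp only [Measure.coe_finsetSum, Finset.sum_apply, Measure.smul_apply, smul_eq_mul]
    refine Finset.measurable_sum _ fun i _ => (A.measurable_query t i).mul ?_
    simp_rw [Measure.map_apply (hsnoc _ i) hs]
    exact measurable_measure_prodMk_left ((measurable_snoc t i) hs)
  rw [Learner.law, Measure.lintegral_bind hk.aemeasurable hf.aemeasurable]
  refine lintegral_congr fun w => ?_
  rw [lintegral_finsetSum_measure]
  refine Finset.sum_congr rfl fun i _ => ?_
  rw [lintegral_smul_measure, lintegral_map hf (hsnoc w i), smul_eq_mul]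

/-- Markov's inequality for a nonnegative supermartingale that is a function of the state. -/
lemma Learner.law_le_of_supermartingale (A : Learner n X) (D : Fin n → Measure (Datum X))
    [∀ i, IsProbabilityMeasure (D i)] {upd : S → Fin n × Datum X → S}
    (hu : Measurable (Function.uncurry upd)) (s₀ : S) (q : S → Fin n → ℝ)
    (hq0 : ∀ s i, 0 ≤ q s i)
    (hq : ∀ t w i, A.query t w i = ENNReal.ofReal (q (run upd s₀ t w) i))
    (φ : ℕ → S → ℝ) (hφm : ∀ t, Measurable (φ t)) (hφ0 : ∀ t s, 0 ≤ φ t s) (hφ1 : φ 0 s₀ ≤ 1)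
    (hstep : ∀ t s, ∃ b : Fin n → Datum X → ℝ, (∀ i, Integrable (b i) (D i)) ∧
      (∀ i z, φ (t + 1) (upd s (i, z)) ≤ φ t s * b i z) ∧ ∑ i, q s i * ∫ z, b i z ∂D i ≤ 1)
    (T : ℕ) {θ : ℝ} (hθ : 0 < θ) :
    A.law D T {w | θ⁻¹ ≤ φ T (run upd s₀ T w)} ≤ ENNReal.ofReal θ := by
  have hm : ∀ t, Measurable fun w : History n X t => ENNReal.ofReal (φ t (run upd s₀ t w)) :=
    fun t => ((hφm t).comp (measurable_run hu s₀ t)).ennreal_ofReal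
  have key : ∀ t, ∫⁻ w, ENNReal.ofReal (φ t (run upd s₀ t w)) ∂A.law D t ≤ 1 := by
    intro t
    induction t with
    | zero =>
      rw [Learner.law, lintegral_dirac' _ (hm 0)]
      exact ENNReal.ofReal_le_one.2 hφ1
    | succ t ih =>
      rw [A.lintegral_law_succ D t (hm (t + 1))]
      refine le_trans (lintegral_mono fun w => ?_) ih
      set s := run upd s₀ t w with hs
      obtain ⟨b, hbi, hb, hsum⟩ := hstep t s
      simp only [run_succ_snoc, hq, ← hs]
      have h1 : ∀ i, ∫⁻ z, ENNReal.ofReal (φ (t + 1) (upd s (i, z))) ∂D i ≤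
          ENNReal.ofReal (∫ z, φ t s * b i z ∂D i) := by
        intro i
        rw [ofReal_integral_eq_lintegral_ofReal ((hbi i).const_mul _)
          (ae_of_all _ fun z => (hφ0 _ _).trans (hb i z))]
        exact lintegral_mono fun z => ENNReal.ofReal_le_ofReal (hb i z)
      have h2 : ∀ i, 0 ≤ ∫ z, φ t s * b i z ∂D i :=
        fun i => integral_nonneg fun z => (hφ0 _ _).trans (hb i z)
      calc _ ≤ ∑ i, ENNReal.ofReal (q s i) * ENNReal.ofReal (∫ z, φ t s * b i z ∂D i) := by
            gcongr with i
            exact h1 i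
        _ = ENNReal.ofReal (∑ i, q s i * ∫ z, φ t s * b i z ∂D i) := by
            rw [ENNReal.ofReal_sum_of_nonneg fun i _ => mul_nonneg (hq0 s i) (h2 i)]
            exact Finset.sum_congr rfl fun i _ => (ENNReal.ofReal_mul (hq0 s i)).symm
        _ ≤ _ := by
            refine ENNReal.ofReal_le_ofReal ?_
            calc _ = φ t s * ∑ i, q s i * ∫ z, b i z ∂D i := by
                  rw [Finset.mul_sum]
                  refine Finset.sum_congr rfl fun i _ => ?_
                  rw [integral_const_mul]
                  ring
              _ ≤ _ := mul_le_of_le_one_right (hφ0 _ _) hsum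
  have hset : {w | θ⁻¹ ≤ φ T (run upd s₀ T w)} ⊆
      {w | ENNReal.ofReal θ⁻¹ ≤ ENNReal.ofReal (φ T (run upd s₀ T w))} :=
    fun w hw => ENNReal.ofReal_le_ofReal hw
  refine (measure_mono hset).trans ((meas_ge_le_lintegral_div (hm T).aemeasurable
    (by simpa using hθ) ENNReal.ofReal_ne_top).trans ?_)
  rw [ENNReal.ofReal_inv_of_pos hθ, div_eq_mul_inv, inv_inv]
  exact mul_le_of_le_one_left' (key T)

end Run

/-! ### The game between a learner on a finite family and an adversary on the oracles -/

section Game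

variable {X : Type u} {n : ℕ} {ι : Type u} [Fintype ι]

/-- The state of the game: the cumulative losses of the family, the cumulative estimated losses of
the adversary's actions, the cumulative weights of the learner, and the learner's cumulative
loss. -/
abbrev GameState (ι : Type u) (n : ℕ) : Type u := (ι → ℝ) × (Fin n → ℝ) × (ι → ℝ) × ℝ

/-- The learner's expected loss on a data point. -/
def mixLoss (ℓ : ι → Datum X → ℝ) (η : ℝ) (s : GameState ι n) (z : Datum X) : ℝ :=
  ∑ f, expWeights η s.1 f * ℓ f z

/-- The implicit-exploration estimate of the adversary's losses. -/
def lossEstimate (ℓ : ι → Datum X → ℝ) (η β : ℝ) (s : GameState ι n) (x : Fin n × Datum X)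
    (i : Fin n) : ℝ :=
  if x.1 = i then (1 - mixLoss ℓ η s x.2) / (expWeights β s.2.1 x.1 + β / 2) else 0

/-- One round of the game. -/
def gameStep (ℓ : ι → Datum X → ℝ) (η β : ℝ) (s : GameState ι n) (x : Fin n × Datum X) :
    GameState ι n :=
  (fun f => s.1 f + ℓ f x.2, fun i => s.2.1 i + lossEstimate ℓ η β s x i,
    fun f => s.2.2.1 f + expWeights η s.1 f, s.2.2.2 + mixLoss ℓ η s x.2)

/-! ### Regret bounds valid on every record -/

section Deterministic

variable {ℓ : ι → Datum X → ℝ} {η β : ℝ}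

/-- The facts about the state that hold on every record. -/
structure GameInvariant (η β : ℝ) (t : ℕ) (s : GameState ι n) : Prop where
  weights_nonneg : ∀ f, 0 ≤ s.2.2.1 f
  sum_weights : ∑ f, s.2.2.1 f = t
  hedge : ∑ f, Real.exp (-η * s.1 f) ≤
    Fintype.card ι * Real.exp (-η * s.2.2.2 + η ^ 2 / 2 * t)
  -- The adversary's total loss is `t - s.2.2.2`. The `β ^ 2` term pays for both the variance and
  -- the bias of its estimates.
  adversary : ∑ i, Real.exp (-β * s.2.1 i) ≤
    n * Real.exp (-β * (t - s.2.2.2) + β ^ 2 * ∑ i, s.2.1 i)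

/-- A single summand of the potential is at most the whole; take logarithms and divide by the
learning rate. -/
lemma GameInvariant.adversary_loss_le [NeZero n] {t : ℕ} {s : GameState ι n}
    (h : GameInvariant η β t s) (hβ : 0 < β) (j : Fin n) :
    t - s.2.2.2 ≤ s.2.1 j + Real.log n / β + β * ∑ i, s.2.1 i := by
  have h1 := (Finset.single_le_sum (f := fun i => Real.exp (-β * s.2.1 i))
    (fun _ _ => (Real.exp_pos _).le) (Finset.mem_univ j)).trans h.adversary
  have hc : (0 : ℝ) < n := by exact_mod_cast NeZero.pos n
  have h2 := Real.log_le_log (Real.exp_pos _) h1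
  rw [Real.log_exp, Real.log_mul hc.ne' (Real.exp_pos _).ne', Real.log_exp] at h2
  refine le_of_mul_le_mul_left ?_ hβ
  have h3 : β * (Real.log n / β) = Real.log n := mul_div_cancel₀ _ hβ.ne'
  nlinarith

variable [Nonempty ι]

lemma mixLoss_mem (hℓ : ∀ f z, ℓ f z ∈ Set.Icc (0 : ℝ) 1) (s : GameState ι n) (z : Datum X) :
    mixLoss ℓ η s z ∈ Set.Icc (0 : ℝ) 1 := by
  refine ⟨Finset.sum_nonneg fun f _ => mul_nonneg (expWeights_pos _ _ _).le (hℓ f z).1, ?_⟩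
  rw [← sum_expWeights η s.1]
  exact Finset.sum_le_sum fun f _ => mul_le_of_le_one_right (expWeights_pos _ _ _).le (hℓ f z).2

lemma lossEstimate_nonneg [NeZero n] (hℓ : ∀ f z, ℓ f z ∈ Set.Icc (0 : ℝ) 1) (hβ : 0 < β)
    (s : GameState ι n) (x : Fin n × Datum X) (i : Fin n) : 0 ≤ lossEstimate ℓ η β s x i := by
  unfold lossEstimate
  have h1 := (mixLoss_mem (η := η) hℓ s x.2).2
  have h2 := expWeights_pos β s.2.1 x.1
  split_ifs
  · exact div_nonneg (by linarith) (by positivity)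
  · exact le_rfl

lemma hedge_step (hℓ : ∀ f z, ℓ f z ∈ Set.Icc (0 : ℝ) 1) (hη : 0 < η) (t : ℝ)
    (s : GameState ι n) (x : Fin n × Datum X)
    (h : ∑ f, Real.exp (-η * s.1 f) ≤
      Fintype.card ι * Real.exp (-η * s.2.2.2 + η ^ 2 / 2 * t)) :
    ∑ f, Real.exp (-η * (gameStep ℓ η β s x).1 f) ≤
      Fintype.card ι * Real.exp (-η * (gameStep ℓ η β s x).2.2.2 + η ^ 2 / 2 * (t + 1)) := by
  refine (sum_exp_add_le η hη.le s.1 (fun f => ℓ f x.2) fun f => (hℓ f _).1).trans ?_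
  have h2 : ∑ f, expWeights η s.1 f * ℓ f x.2 ^ 2 ≤ 1 := by
    rw [← sum_expWeights η s.1]
    exact Finset.sum_le_sum fun f _ => mul_le_of_le_one_right (expWeights_pos _ _ _).le
      (pow_le_one₀ (hℓ f _).1 (hℓ f _).2)
  calc _ ≤ (Fintype.card ι * Real.exp (-η * s.2.2.2 + η ^ 2 / 2 * t)) *
        Real.exp (-η * mixLoss ℓ η s x.2 + η ^ 2 / 2 * 1) := by
        unfold mixLoss
        gcongr
    _ = _ := by
        rw [mul_assoc, ← Real.exp_add, gameStep]
        ring_nf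

lemma adversary_step [NeZero n] (hℓ : ∀ f z, ℓ f z ∈ Set.Icc (0 : ℝ) 1) (hβ : 0 < β) (t : ℝ)
    (s : GameState ι n) (x : Fin n × Datum X)
    (h : ∑ i, Real.exp (-β * s.2.1 i) ≤
      n * Real.exp (-β * (t - s.2.2.2) + β ^ 2 * ∑ i, s.2.1 i)) :
    ∑ i, Real.exp (-β * (gameStep ℓ η β s x).2.1 i) ≤
      n * Real.exp (-β * (t + 1 - (gameStep ℓ η β s x).2.2.2) +
        β ^ 2 * ∑ i, (gameStep ℓ η β s x).2.1 i) := by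
  have hest := lossEstimate_nonneg (η := η) hℓ hβ s x
  refine (sum_exp_add_le β hβ.le s.2.1 (lossEstimate ℓ η β s x) hest).trans ?_
  obtain ⟨j, z⟩ := x
  set a := mixLoss ℓ η s z with ha
  have ha1 : a ≤ 1 := (mixLoss_mem hℓ s z).2
  have ha0 : 0 ≤ a := (mixLoss_mem hℓ s z).1
  set w := expWeights β s.2.1 j with hw
  have hw0 : 0 < w := expWeights_pos _ _ _
  set e := (1 - a) / (w + β / 2) with he
  have he0 : 0 ≤ e := div_nonneg (by linarith) (by positivity)
  have hew : e * (w + β / 2) = 1 - a := div_mul_cancel₀ _ (by positivity)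
  have hest' : ∀ i, lossEstimate ℓ η β s (j, z) i = if j = i then e else 0 := fun i => rfl
  have h1 : ∑ i, expWeights β s.2.1 i * lossEstimate ℓ η β s (j, z) i = w * e := by
    simp [hest', hw]
  have h2 : ∑ i, expWeights β s.2.1 i * lossEstimate ℓ η β s (j, z) i ^ 2 = w * e ^ 2 := by
    simp [hest', hw, ite_pow]
  have h3 : ∑ i, lossEstimate ℓ η β s (j, z) i = e := by simp [hest']
  have hwe : w * e ≤ 1 := by nlinarith
  -- The mean estimate `w * e` falls short of `1 - a` by `βe/2`, and the variance term is at most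
  -- `β²e/2` because `w * e ≤ 1`. The two halves give `β²e`.
  have h4 : -β * (w * e) + β ^ 2 / 2 * (w * e ^ 2) ≤ -β * (1 - a) + β ^ 2 * e := by
    rw [← hew]
    nlinarith [mul_le_mul_of_nonneg_left hwe (mul_nonneg (sq_nonneg β) he0)]
  rw [h1, h2]
  calc _ ≤ (n * Real.exp (-β * (t - s.2.2.2) + β ^ 2 * ∑ i, s.2.1 i)) *
        Real.exp (-β * (1 - a) + β ^ 2 * e) := by gcongr
    _ = _ := by
        rw [mul_assoc, ← Real.exp_add]
        simp only [gameStep, Finset.sum_add_distrib, h3, ← ha]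
        ring_nf

lemma gameInvariant_run [NeZero n] (hℓ : ∀ f z, ℓ f z ∈ Set.Icc (0 : ℝ) 1) (hη : 0 < η)
    (hβ : 0 < β) (t : ℕ) (w : History n X t) :
    GameInvariant η β t (run (gameStep ℓ η β) 0 t w) := by
  refine run_induction _ _ (GameInvariant η β) ?_ ?_ t w
  · constructor <;> simp
  · intro t s x h
    refine ⟨fun f => add_nonneg (h.weights_nonneg f) (expWeights_pos _ _ _).le, ?_, ?_, ?_⟩
    · simp only [gameStep, Finset.sum_add_distrib, h.sum_weights, sum_expWeights]
      push_cast
      rfl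
    · push_cast
      exact hedge_step hℓ hη t s x h.hedge
    · push_cast
      exact adversary_step hℓ hβ t s x h.adversary

lemma GameInvariant.learner_loss_le {t : ℕ} {s : GameState ι n} (h : GameInvariant η β t s)
    (hη : 0 < η) (f : ι) :
    s.2.2.2 ≤ s.1 f + Real.log (Fintype.card ι) / η + η / 2 * t := by
  have h1 := (Finset.single_le_sum (f := fun f => Real.exp (-η * s.1 f))
    (fun _ _ => (Real.exp_pos _).le) (Finset.mem_univ f)).trans h.hedge
  have hc : (0 : ℝ) < Fintype.card ι := by exact_mod_cast Fintype.card_pos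
  have h2 := Real.log_le_log (Real.exp_pos _) h1
  rw [Real.log_exp, Real.log_mul hc.ne' (Real.exp_pos _).ne', Real.log_exp] at h2
  refine le_of_mul_le_mul_left ?_ hη
  have h3 : η * (Real.log (Fintype.card ι) / η) = Real.log (Fintype.card ι) :=
    mul_div_cancel₀ _ hη.ne'
  nlinarith

end Deterministic

/-! ### Measurability, the algorithm, and its three concentration bounds -/

section Stochastic

variable [MeasurableSpace X] {ℓ : ι → Datum X → ℝ} {η β : ℝ}

lemma measurable_gameStep (hm : ∀ f, Measurable (ℓ f)) :
    Measurable (Function.uncurry (gameStep (n := n) ℓ η β)) := by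
  have hmix : Measurable fun p : GameState ι n × (Fin n × Datum X) =>
      mixLoss ℓ η p.1 p.2.2 := by
    have hz : Measurable fun p : GameState ι n × (Fin n × Datum X) => p.2.2 :=
      measurable_snd.comp measurable_snd
    have hp : ∀ f, Measurable fun p : GameState ι n × (Fin n × Datum X) =>
        expWeights η p.1.1 f := fun f =>
      (measurable_expWeights η f).comp (measurable_fst.comp measurable_fst)
    exact Finset.measurable_sum _ fun f _ => (hp f).mul ((hm f).comp hz)
  have h1 : ∀ f, Measurable fun p : GameState ι n × (Fin n × Datum X) =>
      p.1.1 f + ℓ f p.2.2 := by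
    intro f
    have ha : Measurable fun p : GameState ι n × (Fin n × Datum X) => p.1.1 f :=
      (measurable_pi_apply f).comp (measurable_fst.comp measurable_fst)
    have hb : Measurable fun p : GameState ι n × (Fin n × Datum X) => ℓ f p.2.2 :=
      (hm f).comp (measurable_snd.comp measurable_snd)
    exact ha.add hb
  have h2 : ∀ i, Measurable fun p : GameState ι n × (Fin n × Datum X) =>
      p.1.2.1 i + lossEstimate ℓ η β p.1 p.2 i := by
    intro i
    have h : (fun p : GameState ι n × (Fin n × Datum X) => lossEstimate ℓ η β p.1 p.2 i) =
        fun p => if p.2.1 = i then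
          (1 - mixLoss ℓ η p.1 p.2.2) / (expWeights β p.1.2.1 i + β / 2) else 0 := by
      funext p
      unfold lossEstimate
      split_ifs with h
      · rw [h]
      · rfl
    have hC : Measurable fun p : GameState ι n × (Fin n × Datum X) => p.1.2.1 :=
      measurable_fst.comp (measurable_snd.comp measurable_fst)
    refine ((measurable_pi_apply i).comp hC).add ?_
    rw [h]
    refine Measurable.ite ?_ ?_ measurable_const
    · exact (measurable_fst.comp measurable_snd) (MeasurableSet.singleton i)
    · exact (measurable_const.sub hmix).div
        (((measurable_expWeights β i).comp hC).add measurable_const)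
  have h3 : ∀ f, Measurable fun p : GameState ι n × (Fin n × Datum X) =>
      p.1.2.2.1 f + expWeights η p.1.1 f := by
    intro f
    have ha : Measurable fun p : GameState ι n × (Fin n × Datum X) => p.1.2.2.1 f :=
      (measurable_pi_apply f).comp (measurable_fst.comp (measurable_snd.comp
        (measurable_snd.comp measurable_fst)))
    have hb : Measurable fun p : GameState ι n × (Fin n × Datum X) => expWeights η p.1.1 f :=
      (measurable_expWeights η f).comp (measurable_fst.comp measurable_fst)
    exact ha.add hb
  have h4 : Measurable fun p : GameState ι n × (Fin n × Datum X) =>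
      p.1.2.2.2 + mixLoss ℓ η p.1 p.2.2 :=
    (measurable_snd.comp (measurable_snd.comp (measurable_snd.comp measurable_fst))).add hmix
  exact (measurable_pi_lambda _ h1).prodMk ((measurable_pi_lambda _ h2).prodMk
    ((measurable_pi_lambda _ h3).prodMk h4))

lemma measurable_query_gameStep (hm : ∀ f, Measurable (ℓ f)) (t : ℕ) (i : Fin n) :
    Measurable fun w : History n X t =>
      ENNReal.ofReal (expWeights β (run (gameStep ℓ η β) 0 t w).2.1 i) :=
  ((measurable_expWeights β i).comp (measurable_fst.comp (measurable_snd.comp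
    (measurable_run (measurable_gameStep hm) 0 t)))).ennreal_ofReal

lemma integrable_of_mem_Icc (D : Measure (Datum X)) [IsProbabilityMeasure D] {h : Datum X → ℝ}
    (hm : Measurable h) (hh : ∀ z, h z ∈ Set.Icc (0 : ℝ) 1) : Integrable h D :=
  Integrable.of_mem_Icc 0 1 hm.aemeasurable (ae_of_all _ hh)

lemma integral_mem_Icc (D : Measure (Datum X)) [IsProbabilityMeasure D] {h : Datum X → ℝ}
    (hm : Measurable h) (hh : ∀ z, h z ∈ Set.Icc (0 : ℝ) 1) :
    ∫ z, h z ∂D ∈ Set.Icc (0 : ℝ) 1 := by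
  refine ⟨integral_nonneg fun z => (hh z).1, ?_⟩
  refine (integral_mono (integrable_of_mem_Icc D hm hh) (integrable_const 1)
    fun z => (hh z).2).trans ?_
  simp

lemma integral_mixLoss (D : Measure (Datum X)) [IsProbabilityMeasure D]
    (hm : ∀ f, Measurable (ℓ f)) (hℓ : ∀ f z, ℓ f z ∈ Set.Icc (0 : ℝ) 1) (s : GameState ι n) :
    ∫ z, mixLoss ℓ η s z ∂D = ∑ f, expWeights η s.1 f * ∫ z, ℓ f z ∂D := by
  unfold mixLoss
  rw [integral_finsetSum _ fun f _ => (integrable_of_mem_Icc D (hm f) (hℓ f)).const_mul _]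
  simp_rw [integral_const_mul]

variable [Nonempty ι]

lemma integral_one_sub_mixLoss (D : Measure (Datum X)) [IsProbabilityMeasure D]
    (hm : ∀ f, Measurable (ℓ f)) (hℓ : ∀ f z, ℓ f z ∈ Set.Icc (0 : ℝ) 1)
    (s : GameState ι n) (k : ℝ) :
    Integrable (fun z => 1 + k * (1 - mixLoss ℓ η s z)) D ∧
    ∫ z, (1 + k * (1 - mixLoss ℓ η s z)) ∂D = 1 + k * (1 - ∫ z, mixLoss ℓ η s z ∂D) := by
  have hmix : Measurable fun z => mixLoss ℓ η s z :=
    Finset.measurable_sum _ fun f _ => (hm f).const_mul _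
  have h := integrable_of_mem_Icc D hmix (mixLoss_mem hℓ s)
  have h1 : Integrable (fun z => k * (1 - mixLoss ℓ η s z)) D :=
    ((integrable_const 1).sub h).const_mul k
  refine ⟨(integrable_const 1).add h1, ?_⟩
  rw [integral_add (integrable_const 1) h1, integral_const_mul,
    integral_sub (integrable_const 1) h]
  simp

variable [NeZero n]

/-- The average weights of the learner over the first `T` rounds. -/
def averageWeights (hℓ : ∀ f z, ℓ f z ∈ Set.Icc (0 : ℝ) 1) (hη : 0 < η) (hβ : 0 < β) {T : ℕ}
    (hT : 0 < T) (w : History n X T) : PMF ι :=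
  pmfOfReal (fun f => (run (gameStep ℓ η β) 0 T w).2.2.1 f / T)
    (fun f => div_nonneg ((gameInvariant_run hℓ hη hβ T w).weights_nonneg f) T.cast_nonneg)
    (by
      rw [← Finset.sum_div, (gameInvariant_run hℓ hη hβ T w).sum_weights,
        div_self (by exact_mod_cast hT.ne')])

lemma measurable_averageWeights (hm : ∀ f, Measurable (ℓ f))
    (hℓ : ∀ f z, ℓ f z ∈ Set.Icc (0 : ℝ) 1) (hη : 0 < η) (hβ : 0 < β) {T : ℕ}
    (hT : 0 < T) (f : ι) :
    Measurable fun w : History n X T => averageWeights hℓ hη hβ hT w f := by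
  have h : Measurable fun w : History n X T => (run (gameStep ℓ η β) 0 T w).2.2.1 f :=
    (measurable_pi_apply f).comp (measurable_fst.comp (measurable_snd.comp (measurable_snd.comp
      (measurable_run (measurable_gameStep hm) 0 T))))
  exact (h.div_const _).ennreal_ofReal

/-- The sampling algorithm in which the adversary picks the oracle to be called and the learner
returns its average weights. -/
def gameLearner (c : ι → X → Bool) (hm : ∀ f, Measurable (ℓ f))
    (hℓ : ∀ f z, ℓ f z ∈ Set.Icc (0 : ℝ) 1) (hη : 0 < η) (hβ : 0 < β) {T : ℕ} (hT : 0 < T) :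
    Learner n X where
  calls := T
  query t w := pmfOfReal (expWeights β (run (gameStep ℓ η β) 0 t w).2.1)
    (fun _ => (expWeights_pos _ _ _).le) (sum_expWeights _ _)
  measurable_query t i := measurable_query_gameStep hm t i
  output w := (averageWeights hℓ hη hβ hT w).map c
  measurable_output g := by
    classical
    simp only [PMF.map_apply, tsum_fintype]
    refine Finset.measurable_sum _ fun f _ => ?_
    split_ifs
    · exact measurable_averageWeights hm hℓ hη hβ hT f
    · exact measurable_const

/-- Oracle `j` is called with probability `w j`, which cancels the `1 / w j` left by
`exp_implicit_exploration_le`. The exponential thus grows on average by at most `1 + β(1 - μ) ≤ exp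
(β(1 - μ))`, where `1 - μ` is the adversary's expected loss on `D j`. Only this upper deviation is
needed. -/
lemma estimate_concentration (c : ι → X → Bool) (hm : ∀ f, Measurable (ℓ f))
    (hℓ : ∀ f z, ℓ f z ∈ Set.Icc (0 : ℝ) 1) (hη : 0 < η) (hβ : 0 < β) {T : ℕ} (hT : 0 < T)
    (D : Fin n → Measure (Datum X)) [∀ i, IsProbabilityMeasure (D i)] {θ : ℝ} (hθ : 0 < θ)
    (j : Fin n) :
    (gameLearner c hm hℓ hη hβ hT).law D T {w | θ⁻¹ ≤ Real.exp (β *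
      ((run (gameStep ℓ η β) 0 T w).2.1 j - T +
        ∑ f, (run (gameStep ℓ η β) 0 T w).2.2.1 f * ∫ z, ℓ f z ∂D j))} ≤ ENNReal.ofReal θ := by
  refine Learner.law_le_of_supermartingale _ D (measurable_gameStep hm) 0
    (fun s => expWeights β s.2.1) (fun _ _ => (expWeights_pos _ _ _).le) (fun _ _ _ => rfl)
    (fun t s => Real.exp (β * (s.2.1 j - t + ∑ f, s.2.2.1 f * ∫ z, ℓ f z ∂D j)))
    (fun t => by fun_prop) (fun _ _ => (Real.exp_pos _).le) (by simp) ?_ T hθ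
  intro t s
  have hw := expWeights_pos β s.2.1 j
  set w := expWeights β s.2.1 with hw_def
  set μ := ∫ z, mixLoss ℓ η s z ∂D j with hμ
  have hμ' := integral_mixLoss (η := η) (D j) hm hℓ s
  have hint := fun i => integral_one_sub_mixLoss (η := η) (D i) hm hℓ s
    (if i = j then β / w i else 0)
  refine ⟨fun i z => (1 + (if i = j then β / w i else 0) * (1 - mixLoss ℓ η s z)) *
    Real.exp (-(β * (1 - μ))), fun i => (hint i).1.mul_const _, fun i z => ?_, ?_⟩
  · have hmem := mixLoss_mem (η := η) hℓ s z
    have hest : Real.exp (β * lossEstimate ℓ η β s (i, z) j) ≤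
        1 + (if i = j then β / w i else 0) * (1 - mixLoss ℓ η s z) := by
      unfold lossEstimate
      by_cases hij : i = j
      · subst hij
        simp only [if_true]
        refine (exp_implicit_exploration_le hβ (sub_nonneg.2 hmem.2)
          (sub_le_self _ hmem.1) hw).trans (le_of_eq ?_)
        ring
      · simp [hij]
    calc _ = Real.exp (β * (s.2.1 j - t + ∑ f, s.2.2.1 f * ∫ z, ℓ f z ∂D j)) *
          (Real.exp (β * lossEstimate ℓ η β s (i, z) j) * Real.exp (-(β * (1 - μ)))) := by
          rw [← Real.exp_add, ← Real.exp_add, hμ, hμ']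
          simp only [gameStep, add_mul, Finset.sum_add_distrib]
          push_cast
          ring_nf
      _ ≤ _ := mul_le_mul_of_nonneg_left (mul_le_mul_of_nonneg_right (by assumption)
          (Real.exp_pos _).le) (Real.exp_pos _).le
  · simp_rw [integral_mul_const, fun i => (hint i).2, ← mul_assoc]
    rw [← Finset.sum_mul, Real.exp_neg, mul_inv_le_iff₀ (Real.exp_pos _), one_mul]
    have h1 : ∀ i, w i * (1 + (if i = j then β / w i else 0) * (1 - ∫ z, mixLoss ℓ η s z ∂D i)) =
        w i + if i = j then β * (1 - μ) else 0 := by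
      intro i
      by_cases hij : i = j
      · subst hij
        simp only [if_true]
        field_simp
        rfl
      · simp [hij]
    simp_rw [h1]
    rw [Finset.sum_add_distrib, sum_expWeights, Finset.sum_ite_eq' Finset.univ j]
    simp only [Finset.mem_univ, if_true]
    linarith [Real.add_one_le_exp (β * (1 - μ))]

/-- Controls the `β ^ 2` penalty in the adversary's regret. Each oracle contributes at most `β` to
the averaged growth factor after its weight cancels, and `1 + βn ≤ exp (βn)`. -/
lemma estimate_sum_concentration (c : ι → X → Bool) (hm : ∀ f, Measurable (ℓ f))
    (hℓ : ∀ f z, ℓ f z ∈ Set.Icc (0 : ℝ) 1) (hη : 0 < η) (hβ : 0 < β) {T : ℕ} (hT : 0 < T)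
    (D : Fin n → Measure (Datum X)) [∀ i, IsProbabilityMeasure (D i)] {θ : ℝ} (hθ : 0 < θ) :
    (gameLearner c hm hℓ hη hβ hT).law D T {w | θ⁻¹ ≤ Real.exp (β *
      (∑ i, (run (gameStep ℓ η β) 0 T w).2.1 i - n * T))} ≤ ENNReal.ofReal θ := by
  refine Learner.law_le_of_supermartingale _ D (measurable_gameStep hm) 0
    (fun s => expWeights β s.2.1) (fun _ _ => (expWeights_pos _ _ _).le) (fun _ _ _ => rfl)
    (fun t s => Real.exp (β * (∑ i, s.2.1 i - n * t)))
    (fun t => by fun_prop) (fun _ _ => (Real.exp_pos _).le) (by simp) ?_ T hθ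
  intro t s
  have hw := fun i => expWeights_pos β s.2.1 i
  set w := expWeights β s.2.1 with hw_def
  have hint := fun i => integral_one_sub_mixLoss (η := η) (D i) hm hℓ s (β / w i)
  refine ⟨fun i z => (1 + β / w i * (1 - mixLoss ℓ η s z)) *
    Real.exp (-(β * n)), fun i => (hint i).1.mul_const _, fun i z => ?_, ?_⟩
  · have hmem := mixLoss_mem (η := η) hℓ s z
    have hest : Real.exp (β * ∑ j, lossEstimate ℓ η β s (i, z) j) ≤
        1 + β / w i * (1 - mixLoss ℓ η s z) := by
      simp only [lossEstimate, Finset.sum_ite_eq, Finset.mem_univ, if_true]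
      refine (exp_implicit_exploration_le hβ (sub_nonneg.2 hmem.2)
        (sub_le_self _ hmem.1) (hw i)).trans (le_of_eq ?_)
      ring
    calc _ = Real.exp (β * (∑ i, s.2.1 i - n * t)) *
          (Real.exp (β * ∑ j, lossEstimate ℓ η β s (i, z) j) * Real.exp (-(β * n))) := by
          rw [← Real.exp_add, ← Real.exp_add]
          simp only [gameStep, Finset.sum_add_distrib]
          push_cast
          ring_nf
      _ ≤ _ := mul_le_mul_of_nonneg_left (mul_le_mul_of_nonneg_right (by assumption)
          (Real.exp_pos _).le) (Real.exp_pos _).le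
  · simp_rw [integral_mul_const, fun i => (hint i).2, ← mul_assoc]
    rw [← Finset.sum_mul, Real.exp_neg, mul_inv_le_iff₀ (Real.exp_pos _), one_mul]
    have h1 : ∀ i, w i * (1 + β / w i * (1 - ∫ z, mixLoss ℓ η s z ∂D i)) ≤ w i + β := by
      intro i
      have h2 : w i * (β / w i) = β := mul_div_cancel₀ _ (hw i).ne'
      have h3 : 0 ≤ ∫ z, mixLoss ℓ η s z ∂D i := integral_nonneg fun z => (mixLoss_mem hℓ s z).1
      rw [mul_add, mul_one, ← mul_assoc, h2]
      nlinarith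
    refine (Finset.sum_le_sum fun i _ => h1 i).trans ?_
    rw [Finset.sum_add_distrib, sum_expWeights]
    simp only [Finset.sum_const, Finset.card_univ, Fintype.card_fin, nsmul_eq_mul]
    linarith [Real.add_one_le_exp (β * n)]

/-- Since `V` bounds the risk under every oracle, the adversary's adaptive choices are harmless. The
extra `η` comes from `exp y ≤ 1 + y + y²` on `[0, 1]`. -/
lemma comparator_concentration (c : ι → X → Bool) (hm : ∀ f, Measurable (ℓ f))
    (hℓ : ∀ f z, ℓ f z ∈ Set.Icc (0 : ℝ) 1) (hη : 0 < η) (hη1 : η ≤ 1) (hβ : 0 < β) {T : ℕ}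
    (hT : 0 < T) (D : Fin n → Measure (Datum X)) [∀ i, IsProbabilityMeasure (D i)] {θ : ℝ}
    (hθ : 0 < θ) (f : ι) {V : ℝ} (hV : ∀ i, ∫ z, ℓ f z ∂D i ≤ V) :
    (gameLearner c hm hℓ hη hβ hT).law D T {w | θ⁻¹ ≤ Real.exp (η *
      ((run (gameStep ℓ η β) 0 T w).1 f - (V + η) * T))} ≤ ENNReal.ofReal θ := by
  refine Learner.law_le_of_supermartingale _ D (measurable_gameStep hm) 0
    (fun s => expWeights β s.2.1) (fun _ _ => (expWeights_pos _ _ _).le) (fun _ _ _ => rfl)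
    (fun t s => Real.exp (η * (s.1 f - (V + η) * t)))
    (fun t => by fun_prop) (fun _ _ => (Real.exp_pos _).le) (by simp) ?_ T hθ
  intro t s
  have hint : ∀ i, Integrable (fun z => 1 + (η + η ^ 2) * ℓ f z) (D i) := fun i =>
    (integrable_const 1).add ((integrable_of_mem_Icc (D i) (hm f) (hℓ f)).const_mul _)
  refine ⟨fun i z => (1 + (η + η ^ 2) * ℓ f z) * Real.exp (-(η * (V + η))),
    fun i => (hint i).mul_const _, fun i z => ?_, ?_⟩
  · obtain ⟨h0, h1⟩ := hℓ f z
    have hexp : Real.exp (η * ℓ f z) ≤ 1 + (η + η ^ 2) * ℓ f z := by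
      have h2 : |η * ℓ f z| ≤ 1 := by
        rw [abs_of_nonneg (by positivity)]
        exact mul_le_one₀ hη1 h0 h1
      have h3 := (abs_le.1 (Real.abs_exp_sub_one_sub_id_le h2)).2
      nlinarith [mul_nonneg (sq_nonneg η) (mul_nonneg h0 (sub_nonneg.2 h1))]
    calc _ = Real.exp (η * (s.1 f - (V + η) * t)) *
          (Real.exp (η * ℓ f z) * Real.exp (-(η * (V + η)))) := by
          rw [← Real.exp_add, ← Real.exp_add]
          simp only [gameStep]
          push_cast
          ring_nf
      _ ≤ _ := mul_le_mul_of_nonneg_left (mul_le_mul_of_nonneg_right (by assumption)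
          (Real.exp_pos _).le) (Real.exp_pos _).le
  · have h1 : ∀ i, ∫ z, (1 + (η + η ^ 2) * ℓ f z) * Real.exp (-(η * (V + η))) ∂D i ≤ 1 := by
      intro i
      have h2 := integral_mem_Icc (D i) (hm f) (hℓ f)
      rw [integral_mul_const, integral_add (integrable_const 1)
        ((integrable_of_mem_Icc (D i) (hm f) (hℓ f)).const_mul _), integral_const_mul,
        Real.exp_neg, mul_inv_le_iff₀ (Real.exp_pos _), one_mul]
      simp only [integral_const, probReal_univ, smul_eq_mul, mul_one]
      nlinarith [Real.add_one_le_exp (η * (V + η)), mul_le_mul_of_nonneg_left (hV i) hη.le,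
        mul_le_mul_of_nonneg_left h2.2 (sq_nonneg η)]
    exact (Finset.sum_le_sum fun i _ => mul_le_of_le_one_right (expWeights_pos _ _ _).le
      (h1 i)).trans (sum_expWeights β s.2.1).le

end Stochastic
end Game

/-! ### The sampling guarantee for a finite family -/

section FiniteFamily

/-- `A` is the learner's loss, `L` the comparator's, `C` the estimated loss of oracle `j`, `S` the
sum of all estimates, and `M` the cumulative mixture risk under `D j`. `h1`, `h2` are the regret
bounds and `h3`–`h5` the concentration bounds. In the sum, the terms in `κT` total `5/16`, and the
others are at most `25(m + nΛ)/κ ≤ (25/128)κT`. -/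
lemma mixture_loss_le {κ Λ T n m L A C S M V : ℝ} (hκ0 : 0 < κ) (hκ1 : κ ≤ 1) (hn : 1 ≤ n)
    (hm : 0 ≤ m) (hΛ : 0 ≤ Λ) (hnΛ : Real.log n ≤ Λ) (hT : 128 * (m + n * Λ) ≤ κ ^ 2 * T)
    (h1 : A ≤ L + m / (κ / 8) + κ / 8 / 2 * T)
    (h2 : T - A ≤ C + Real.log n / (κ / (8 * n)) + κ / (8 * n) * S)
    (h3 : κ / (8 * n) * (C - T + M) ≤ Λ) (h4 : κ / (8 * n) * (S - n * T) ≤ Λ)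
    (h5 : κ / 8 * (L - (V + κ / 8) * T) ≤ Λ) : M ≤ (V + κ) * T := by
  have e1 : κ / (8 * n) * n = κ / 8 := by field_simp
  have h3' : C - T + M ≤ 8 * n * Λ / κ := by
    rw [le_div_iff₀ hκ0]
    have : κ / (8 * n) * (C - T + M) * (8 * n) ≤ Λ * (8 * n) := by gcongr
    have e : κ / (8 * n) * (C - T + M) * (8 * n) = (C - T + M) * κ := by field_simp
    linarith
  have h5' : L - (V + κ / 8) * T ≤ 8 * Λ / κ := by
    rw [le_div_iff₀ hκ0]
    linarith
  have h4' : κ / (8 * n) * S ≤ Λ + κ / 8 * T := by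
    have : κ / (8 * n) * (S - n * T) = κ / (8 * n) * S - κ / (8 * n) * n * T := by ring
    rw [this, e1] at h4
    linarith
  have h6 : Real.log n / (κ / (8 * n)) ≤ 8 * n * Λ / κ := by
    rw [div_div_eq_mul_div]
    gcongr ?_ / _
    nlinarith
  have h7 : m / (κ / 8) = 8 * m / κ := by field_simp
  have h8 : 128 * ((m + n * Λ) / κ) ≤ κ * T := by
    rw [← mul_div_assoc, div_le_iff₀ hκ0]
    linarith
  have h9 : Λ ≤ n * Λ := by nlinarith
  have h10 : Λ / κ ≤ n * Λ / κ := by gcongr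
  have h11 : Λ ≤ Λ / κ := by
    rw [le_div_iff₀ hκ0]
    nlinarith
  have h12 : 0 ≤ m / κ := by positivity
  have h13 : 0 ≤ n * Λ / κ := by positivity
  rw [add_div] at h8
  rw [mul_div_assoc] at h7 h5'
  rw [mul_assoc, mul_div_assoc] at h3' h6
  rw [h7] at h1
  have h14 : 0 ≤ κ * T := by linarith
  linarith

variable {X : Type u} [MeasurableSpace X] {n : ℕ} [NeZero n] {ι : Type u} [Fintype ι] [Nonempty ι]
  {ℓ : ι → Datum X → ℝ}

theorem gameLearner_guarantee (c : ι → X → Bool) (hm : ∀ f, Measurable (ℓ f))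
    (hℓ : ∀ f z, ℓ f z ∈ Set.Icc (0 : ℝ) 1) {κ δ : ℝ} (hκ0 : 0 < κ) (hκ1 : κ ≤ 1) (hδ0 : 0 < δ)
    (hδ1 : δ < 1) {T : ℕ} (hT : 0 < T) (hη : 0 < κ / 8) (hβ : 0 < κ / (8 * n))
    (hT' : 128 * (Real.log (Fintype.card ι) + n * Real.log (3 * n / δ)) ≤ κ ^ 2 * T)
    (D : Fin n → Measure (Datum X)) [∀ i, IsProbabilityMeasure (D i)] (f : ι) {V : ℝ}
    (hV : ∀ i, ∫ z, ℓ f z ∂D i ≤ V) :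
    (gameLearner c hm hℓ hη hβ hT).law D T {w | ∃ j, V + κ <
      ∑ f, (averageWeights hℓ hη hβ hT w f).toReal * ∫ z, ℓ f z ∂D j} ≤ ENNReal.ofReal δ := by
  set μ := (gameLearner c hm hℓ hη hβ hT).law D T
  have hn : (1 : ℝ) ≤ n := by exact_mod_cast NeZero.one_le
  -- There are `n + 2 ≤ 3n` bad events.
  set θ := δ / (3 * n) with hθ_def
  have hθ : 0 < θ := by positivity
  set s : History n X T → GameState ι n := run (gameStep ℓ (κ / 8) (κ / (8 * n))) 0 T
  set E₁ : Fin n → Set (History n X T) := fun j => {w | θ⁻¹ ≤ Real.exp (κ / (8 * n) *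
      ((s w).2.1 j - T + ∑ f, (s w).2.2.1 f * ∫ z, ℓ f z ∂D j))} with hE₁
  set E₂ : Set (History n X T) := {w | θ⁻¹ ≤ Real.exp (κ / (8 * n) *
      (∑ i, (s w).2.1 i - n * T))} with hE₂
  set E₃ : Set (History n X T) := {w | θ⁻¹ ≤ Real.exp (κ / 8 *
      ((s w).1 f - (V + κ / 8) * T))} with hE₃
  have hsub : {w | ∃ j, V + κ <
      ∑ f, (averageWeights hℓ hη hβ hT w f).toReal * ∫ z, ℓ f z ∂D j} ⊆
      (⋃ j, E₁ j) ∪ (E₂ ∪ E₃) := by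
    rintro w ⟨j, hj⟩
    by_contra hw
    simp only [Set.mem_union, Set.mem_iUnion, not_or, not_exists] at hw
    obtain ⟨hw1, hw2, hw3⟩ := hw
    have hlog : ∀ x, ¬ θ⁻¹ ≤ Real.exp x → x ≤ Real.log (3 * n / δ) := by
      intro x hx
      rw [Real.le_log_iff_exp_le (by positivity)]
      refine (not_le.1 hx).le.trans (le_of_eq ?_)
      rw [hθ_def, inv_div]
    have hinv : GameInvariant (κ / 8) (κ / (8 * n)) T (s w) := gameInvariant_run hℓ hη hβ T w
    have hlogn : Real.log n ≤ Real.log (3 * n / δ) := by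
      refine Real.log_le_log (by linarith) ?_
      rw [le_div_iff₀ hδ0]
      nlinarith
    have hΛ : 0 ≤ Real.log (3 * n / δ) := (Real.log_nonneg hn).trans hlogn
    have h := mixture_loss_le hκ0 hκ1 hn (Real.log_nonneg (by exact_mod_cast Fintype.card_pos))
      hΛ hlogn hT' (hinv.learner_loss_le hη f) (hinv.adversary_loss_le hβ j)
      (hlog _ (hw1 j)) (hlog _ hw2) (hlog _ hw3)
    have hTpos : (0 : ℝ) < T := by exact_mod_cast hT
    have h2 : ∀ f, (averageWeights hℓ hη hβ hT w f).toReal = (s w).2.2.1 f / T := fun f =>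
      ENNReal.toReal_ofReal (div_nonneg (hinv.weights_nonneg f) hTpos.le)
    simp_rw [h2, div_mul_eq_mul_div] at hj
    rw [← Finset.sum_div, lt_div_iff₀ hTpos] at hj
    exact absurd hj (not_lt.2 h)
  refine (measure_mono hsub).trans ?_
  have b1 : ∀ j, μ (E₁ j) ≤ ENNReal.ofReal θ := fun j =>
    estimate_concentration c hm hℓ hη hβ hT D hθ j
  have b2 : μ E₂ ≤ ENNReal.ofReal θ := estimate_sum_concentration c hm hℓ hη hβ hT D hθ
  have b3 : μ E₃ ≤ ENNReal.ofReal θ :=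
    comparator_concentration c hm hℓ hη (by linarith) hβ hT D hθ f hV
  calc μ ((⋃ j, E₁ j) ∪ (E₂ ∪ E₃)) ≤ (∑ j, μ (E₁ j)) + (μ E₂ + μ E₃) :=
        (measure_union_le _ _).trans (add_le_add (measure_iUnion_fintype_le _ _)
          (measure_union_le _ _))
    _ ≤ (∑ _j : Fin n, ENNReal.ofReal θ) + (ENNReal.ofReal θ + ENNReal.ofReal θ) := by
        gcongr with j
        exact b1 j
    _ = ENNReal.ofReal ((n + 2) * θ) := by
        rw [Finset.sum_const, Finset.card_univ, Fintype.card_fin, nsmul_eq_mul,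
          ← ENNReal.ofReal_add hθ.le hθ.le, ← ENNReal.ofReal_natCast n,
          ← ENNReal.ofReal_mul (Nat.cast_nonneg n), ← ENNReal.ofReal_add (by positivity)
          (by positivity)]
        ring_nf
    _ ≤ ENNReal.ofReal δ := by
        refine ENNReal.ofReal_le_ofReal ?_
        rw [hθ_def, mul_div_assoc', div_le_iff₀ (by positivity)]
        nlinarith

end FiniteFamily

/-! ### Randomized classifiers and nets -/

section Nets

variable {X : Type u} {n : ℕ} {g : Bool → Bool → ℝ}

/-- Two distinct members would shatter a point where they differ. -/
lemma eq_of_vcDim_eq_zero {H : Set (X → Bool)} (h0 : vcDim H = 0) {h h' : X → Bool}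
    (hh : h ∈ H) (hh' : h' ∈ H) : h = h' := by
  by_contra hne
  obtain ⟨x, hx⟩ := Function.ne_iff.1 hne
  have hs : Shatters H {x} := by
    intro y
    by_cases hy : h x = y x
    · exact ⟨h, hh, by simpa using hy⟩
    · refine ⟨h', hh', ?_⟩
      simp only [Finset.mem_singleton, forall_eq]
      revert hx hy
      cases h x <;> cases h' x <;> cases y x <;> simp
  have h1 : ((({x} : Finset X).card : ℕ) : ℕ∞) ≤ vcDim H :=
    le_iSup₂ (f := fun (S : Finset X) (_ : Shatters H S) => (S.card : ℕ∞)) {x} hs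
  rw [h0] at h1
  simp at h1

variable [MeasurableSpace X]

lemma measurable_loss (g : Bool → Bool → ℝ) {h : X → Bool} (hh : Measurable h) :
    Measurable fun z : Datum X => g (h z.1) z.2 :=
  (measurable_of_finite fun p : Bool × Bool => g p.1 p.2).comp
    ((hh.comp measurable_fst).prodMk measurable_snd)

lemma risk_mem_Icc (hg : ∀ a b, g a b ∈ Set.Icc (0 : ℝ) 1) (D : Measure (Datum X))
    [IsProbabilityMeasure D] {h : X → Bool} (hh : Measurable h) :
    risk g D h ∈ Set.Icc (0 : ℝ) 1 :=
  integral_mem_Icc D (measurable_loss g hh) fun _ => hg _ _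

lemma risk_le_add_of_disagreement (hg : ∀ a b, g a b ∈ Set.Icc (0 : ℝ) 1)
    (D : Measure (Datum X)) [IsProbabilityMeasure D] {h f : X → Bool} (hh : Measurable h)
    (hf : Measurable f) {r : ℝ} (hr : 0 ≤ r)
    (hd : D {z | h z.1 ≠ f z.1} ≤ ENNReal.ofReal r) : risk g D f ≤ risk g D h + r := by
  set s : Set (Datum X) := {z | h z.1 ≠ f z.1} with hs_def
  have hs : MeasurableSet s :=
    (measurableSet_eq_fun (hh.comp measurable_fst) (hf.comp measurable_fst)).compl
  have hih := integrable_of_mem_Icc D (measurable_loss g hh) fun _ => hg _ _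
  have hif := integrable_of_mem_Icc D (measurable_loss g hf) fun _ => hg _ _
  have his : Integrable (s.indicator fun _ => (1 : ℝ)) D := (integrable_const 1).indicator hs
  have h1 : risk g D f ≤ ∫ z, (g (h z.1) z.2 + s.indicator (fun _ => (1 : ℝ)) z) ∂D := by
    refine integral_mono hif (hih.add his) fun z => ?_
    by_cases hz : h z.1 = f z.1
    · simp [hs_def, hz]
    · have hz' : z ∈ s := hz
      simp only [Set.indicator_of_mem hz']
      linarith [(hg (f z.1) z.2).2, (hg (h z.1) z.2).1]
  rw [integral_add hih his, integral_indicator_const _ hs] at h1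
  have h2 : D.real s ≤ r := ENNReal.toReal_le_of_le_ofReal hr hd
  simp only [smul_eq_mul, mul_one] at h1
  unfold risk at h1 ⊢
  linarith

lemma randRisk_map_val (D : Measure (Datum X)) (N : Finset (X → Bool)) (p : PMF N) :
    randRisk g D (p.map Subtype.val) = ∑ f : N, (p f).toReal * risk g D f := by
  classical
  have hval : ∀ f : N, (p.map Subtype.val) (f : X → Bool) = p f := by
    intro f
    rw [PMF.map_apply, tsum_eq_single f]
    · simp
    · intro f' hf'
      rw [if_neg fun h => hf' (Subtype.ext h.symm)]
  rw [randRisk, tsum_eq_sum (s := N)]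
  · rw [← Finset.sum_coe_sort N]
    exact Finset.sum_congr rfl fun f _ => by rw [hval]
  · intro f hf
    have h0 : (p.map Subtype.val) f = 0 := by
      rw [PMF.apply_eq_zero_iff, PMF.mem_support_map_iff]
      rintro ⟨a, -, rfl⟩
      exact hf a.2
    simp [h0]

lemma randRisk_pure (D : Measure (Datum X)) (h : X → Bool) :
    randRisk g D (PMF.pure h) = risk g D h := by
  classical
  rw [randRisk, tsum_eq_single h]
  · simp
  · intro f hf
    simp [PMF.pure_apply, hf]

/-- `opt` need not be attained on `H`, so the minimizer over the finite set `N` is chosen and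
compared with the representative of every `h`. -/
lemma exists_mem_net_risk_le {D : Fin n → Measure (Datum X)} [NeZero n]
    [∀ i, IsProbabilityMeasure (D i)]
    {H : Set (X → Bool)} {N : Finset (X → Bool)} {r : ℝ} (hr : 0 ≤ r) (hH : H.Nonempty)
    (hHm : ∀ h ∈ H, Measurable h) (hNm : ∀ f ∈ N, Measurable f)
    (hg : ∀ a b, g a b ∈ Set.Icc (0 : ℝ) 1) (hN : IsNet D H r N) :
    ∃ f : N, ∀ i, risk g (D i) f ≤ opt g D H + r := by
  obtain ⟨h₀, hh₀⟩ := hH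
  obtain ⟨f₀, hf₀, -⟩ := hN h₀ hh₀
  obtain ⟨f, hf, hmin⟩ := N.exists_min_image (fun f => ⨆ i, risk g (D i) f) ⟨f₀, hf₀⟩
  refine ⟨⟨f, hf⟩, fun i => ?_⟩
  refine (le_ciSup (f := fun i => risk g (D i) f) (Set.finite_range _).bddAbove i).trans ?_
  have : Nonempty H := ⟨⟨h₀, hh₀⟩⟩
  rw [← sub_le_iff_le_add, opt]
  refine le_ciInf fun ⟨h, hh⟩ => ?_
  rw [sub_le_iff_le_add]
  obtain ⟨f', hf', hd⟩ := hN h hh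
  refine (hmin f' hf').trans (ciSup_le fun j => ?_)
  refine (risk_le_add_of_disagreement hg (D j) (hHm h hh) (hNm f' hf') hr (hd j)).trans ?_
  gcongr
  exact le_ciSup (f := fun i => risk g (D i) h) (Set.finite_range _).bddAbove j

lemma opt_nonneg {D : Fin n → Measure (Datum X)} {H : Set (X → Bool)}
    (hg : ∀ a b, g a b ∈ Set.Icc (0 : ℝ) 1) : 0 ≤ opt g D H :=
  Real.iInf_nonneg fun _ => Real.iSup_nonneg fun _ => integral_nonneg fun _ => (hg _ _).1

/-- The algorithm that calls no oracle. -/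
def constLearner (X : Type u) [MeasurableSpace X] (n : ℕ) [NeZero n] (q : PMF (X → Bool)) :
    Learner n X where
  calls := 0
  query _ _ := PMF.pure 0
  measurable_query _ _ := measurable_const
  output _ := q
  measurable_output _ := measurable_const

lemma isEpsOptimal_pure_of_vcDim_eq_zero {D : Fin n → Measure (Datum X)} {H : Set (X → Bool)}
    (h0 : vcDim H = 0) {h : X → Bool} (hh : h ∈ H) {ε : ℝ} (hε : 0 ≤ ε) :
    IsEpsOptimal g D H ε (PMF.pure h) := by
  have : Nonempty H := ⟨⟨h, hh⟩⟩
  simp only [IsEpsOptimal, randRisk_pure]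
  have h1 : (⨆ i, risk g (D i) h) ≤ opt g D H :=
    le_ciInf fun ⟨h', hh'⟩ => by rw [eq_of_vcDim_eq_zero h0 hh hh']
  linarith

/-- One member of `N` has risk at most `opt + γε` everywhere and the others at most `1`, so the
average is at most `opt + 1 - (1 - γ)/|N|`. -/
lemma isEpsOptimal_uniform [NeZero n] {D : Fin n → Measure (Datum X)}
    [∀ i, IsProbabilityMeasure (D i)]
    {H : Set (X → Bool)} {N : Finset (X → Bool)} {γ ε : ℝ} (hγ0 : 0 < γ) (hε0 : 0 < ε) (hε1 : ε ≤ 1)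
    (hH : H.Nonempty)
    (hHm : ∀ h ∈ H, Measurable h) (hNm : ∀ f ∈ N, Measurable f)
    (hg : ∀ a b, g a b ∈ Set.Icc (0 : ℝ) 1) (hN : IsNet D H (γ * ε) N) [Nonempty N]
    (hε : 1 - (1 - γ) / N.card ≤ ε) :
    IsEpsOptimal g D H ε ((PMF.uniformOfFintype N).map Subtype.val) := by
  classical
  obtain ⟨f, hf⟩ := exists_mem_net_risk_le (by positivity) hH hHm hNm hg hN
  have hopt := opt_nonneg (D := D) (H := H) hg
  have hcard : (1 : ℝ) ≤ N.card := by
    have : 0 < N.card := Finset.card_pos.2 ⟨f, f.2⟩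
    exact_mod_cast this
  refine ciSup_le fun i => ?_
  rw [randRisk_map_val]
  simp only [PMF.uniformOfFintype_apply, Fintype.card_coe, ENNReal.toReal_inv,
    ENNReal.toReal_natCast]
  rw [← Finset.mul_sum, inv_mul_le_iff₀ (by linarith)]
  have h1 : ∑ f' : N, risk g (D i) f' ≤ ∑ f' : N, (1 + if f' = f then
      opt g D H + γ * ε - 1 else 0) := by
    refine Finset.sum_le_sum fun f' _ => ?_
    split_ifs with h
    · rw [h]
      linarith [hf i]
    · linarith [(risk_mem_Icc hg (D i) (hNm f' f'.2)).2]
  refine h1.trans ?_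
  rw [Finset.sum_add_distrib, Finset.sum_ite_eq' Finset.univ f]
  simp only [Finset.sum_const, Finset.card_univ, Fintype.card_coe, nsmul_eq_mul, mul_one,
    Finset.mem_univ, if_true]
  have h2 : (N.card : ℝ) * (1 - (1 - γ) / N.card) = N.card - (1 - γ) := by field_simp
  have h3 : (N.card : ℝ) * (1 - (1 - γ) / N.card) ≤ N.card * ε := by gcongr
  have h4 : γ * ε ≤ γ := mul_le_of_le_one_right hγ0.le hε1
  have h5 : opt g D H ≤ N.card * opt g D H := le_mul_of_one_le_left hopt hcard
  linarith

end Nets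

/-! ### The sample complexity -/

/-- Dominates an arbitrary polynomial by one power, whose logarithm costs only the factor `k`. -/
lemma exists_abs_eval_le {σ : Type*} (P : MvPolynomial σ ℝ) :
    ∃ S : ℝ, 1 ≤ S ∧ ∃ k : ℕ, ∀ (x : σ → ℝ) (Y : ℝ), 1 ≤ Y → (∀ i, |x i| ≤ Y) →
      |MvPolynomial.eval x P| ≤ S * Y ^ k := by
  induction P using MvPolynomial.induction_on with
  | C a => exact ⟨|a| + 1, by simp, 0, fun x Y _ _ => by simp⟩
  | add p q hp hq =>
    obtain ⟨S, hS, k, h⟩ := hp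
    obtain ⟨S', hS', k', h'⟩ := hq
    refine ⟨S + S', by linarith, max k k', fun x Y hY hx => ?_⟩
    rw [map_add, add_mul]
    refine (abs_add_le _ _).trans (add_le_add ((h x Y hY hx).trans ?_) ((h' x Y hY hx).trans ?_))
    · gcongr
      exact le_max_left _ _
    · gcongr
      exact le_max_right _ _
  | mul_X p i hp =>
    obtain ⟨S, hS, k, h⟩ := hp
    refine ⟨S, hS, k + 1, fun x Y hY hx => ?_⟩
    rw [map_mul, MvPolynomial.eval_X, abs_mul, pow_succ, ← mul_assoc]
    exact mul_le_mul (h x Y hY hx) (hx i) (abs_nonneg _) (by positivity)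

/-- The sample complexity up to the factor `C / ε ^ 2`. -/
def complexity (n d : ℕ) (ε δ : ℝ) : ℝ :=
  d * Real.log (d * n / ε) + n * Real.log (n / δ)

section Complexity

variable {n d : ℕ} {ε δ : ℝ}

lemma one_le_mul_div (hn : 1 ≤ n) (hd : 1 ≤ d) (hε0 : 0 < ε) (hε1 : ε < 1) :
    (1 : ℝ) ≤ d * n / ε := by
  have h1 : (1 : ℝ) ≤ d * n := by exact_mod_cast Nat.mul_le_mul hd hn
  rw [le_div_iff₀ hε0]
  linarith

lemma log_div_nonneg (hn : 1 ≤ n) (hδ0 : 0 < δ) (hδ1 : δ < 1) : 0 ≤ Real.log (n / δ) := by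
  have h1 : (1 : ℝ) ≤ n := by exact_mod_cast hn
  refine Real.log_nonneg ?_
  rw [le_div_iff₀ hδ0]
  linarith

lemma complexity_nonneg (hn : 1 ≤ n) (hε0 : 0 < ε) (hε1 : ε < 1) (hδ0 : 0 < δ) (hδ1 : δ < 1) :
    0 ≤ complexity n d ε δ := by
  refine add_nonneg ?_ (mul_nonneg n.cast_nonneg (log_div_nonneg hn hδ0 hδ1))
  rcases Nat.eq_zero_or_pos d with rfl | hd
  · simp
  · exact mul_nonneg d.cast_nonneg (Real.log_nonneg (one_le_mul_div hn hd hε0 hε1))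

/-- If `dn/ε ≥ 2`, the first summand is at least `log 2`. Otherwise `d = n = 1` and `m ≤ S 2^k`, so
`log (1/ε) ≥ 1 - ε ≥ (1 - γ)/m` is bounded below. -/
lemma complexity_lower_bound {S γ m : ℝ} {k : ℕ} (hγ1 : γ < 1) (hn : 1 ≤ n) (hd : 1 ≤ d)
    (hε0 : 0 < ε) (hε1 : ε < 1) (hδ0 : 0 < δ) (hδ1 : δ < 1) (hm1 : 1 ≤ m)
    (hm : m ≤ S * ((d * n / ε) ^ d) ^ k) (hε : ε ≤ 1 - (1 - γ) / m) (hS : 1 ≤ S) :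
    min (Real.log 2) ((1 - γ) / (S * 2 ^ k)) ≤ complexity n d ε δ := by
  have h1 : Real.log (d * n / ε) ≤ complexity n d ε δ := by
    have hd' : (1 : ℝ) ≤ d := by exact_mod_cast hd
    have := Real.log_nonneg (one_le_mul_div hn hd hε0 hε1)
    have h2 := mul_nonneg (Nat.cast_nonneg (α := ℝ) n) (log_div_nonneg hn hδ0 hδ1)
    unfold complexity
    nlinarith
  refine le_trans ?_ h1
  by_cases h2 : 2 ≤ (d * n / ε : ℝ)
  · exact (min_le_left _ _).trans (Real.log_le_log (by norm_num) h2)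
  · refine (min_le_right _ _).trans ?_
    have h3 : d * n = 1 := by
      by_contra h4
      have h5 : 2 ≤ d * n := by
        have := Nat.mul_le_mul hd hn
        omega
      have h6 : (2 : ℝ) ≤ d * n := by exact_mod_cast h5
      refine h2 ?_
      rw [le_div_iff₀ hε0]
      nlinarith
    obtain ⟨rfl, rfl⟩ := mul_eq_one.1 h3
    simp only [Nat.cast_one, mul_one, pow_one] at hm h2 ⊢
    have h4 : m ≤ S * 2 ^ k := by
      refine hm.trans ?_
      gcongr
      exact (not_le.1 h2).le
    have h5 : (1 - γ) / (S * 2 ^ k) ≤ (1 - γ) / m := by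
      gcongr
    rw [one_div, Real.log_inv]
    linarith [Real.log_le_sub_one_of_pos hε0]

lemma natCast_mul_log_three_le (hn : 1 ≤ n) : n * Real.log 3 ≤ 2 * (n * Real.log n) + 2 := by
  have hlog4 : Real.log 3 ≤ 2 * Real.log 2 := by
    rw [← Real.log_rpow (by norm_num)]
    exact Real.log_le_log (by norm_num) (by norm_num)
  rcases hn.eq_or_lt with rfl | hn
  · have := Real.log_two_lt_d9
    norm_num
    linarith
  · have h2 : Real.log 2 ≤ Real.log n :=
      Real.log_le_log (by norm_num) (by exact_mod_cast hn)
    have hn' : (0 : ℝ) ≤ n := n.cast_nonneg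
    nlinarith

/-- The `k` comes from `log m`. The `3` is one `n log (n/δ)` plus the two `n log n` that absorb `n
log 3`. The leftover constant `log S + 2` is absorbed using `u ≤ complexity n d ε δ`. -/
lemma log_add_le_complexity {S m u : ℝ} {k : ℕ} (hn : 1 ≤ n) (hd : 1 ≤ d)
    (hε0 : 0 < ε) (hε1 : ε < 1) (hδ0 : 0 < δ) (hδ1 : δ < 1) (hm1 : 1 ≤ m)
    (hm : m ≤ S * ((d * n / ε) ^ d) ^ k) (hS : 1 ≤ S) (hu : 0 < u)
    (hU : u ≤ complexity n d ε δ) :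
    Real.log m + n * Real.log (3 * n / δ) ≤
      (k + 3 + (Real.log S + 2) / u) * complexity n d ε δ := by
  have hn0 : (0 : ℝ) < n := by exact_mod_cast hn
  have hY := one_le_mul_div hn hd hε0 hε1
  have hY0 : (0 : ℝ) < d * n / ε := by linarith
  have h1 : Real.log m ≤ Real.log S + k * (d * Real.log (d * n / ε)) := by
    refine (Real.log_le_log (by linarith) hm).trans (le_of_eq ?_)
    rw [Real.log_mul (by positivity) (by positivity), Real.log_pow, Real.log_pow]
  have h2 : n * Real.log (3 * n / δ) = n * Real.log 3 + n * Real.log (n / δ) := by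
    rw [mul_div_assoc, Real.log_mul (by norm_num) (by positivity)]
    ring
  have h3 := natCast_mul_log_three_le hn
  have h4 : Real.log n ≤ Real.log (n / δ) := by
    refine Real.log_le_log hn0 ?_
    rw [le_div_iff₀ hδ0]
    nlinarith
  have h5 : n * Real.log n ≤ n * Real.log (n / δ) := by gcongr
  have h6 : 0 ≤ d * Real.log (d * n / ε) := mul_nonneg d.cast_nonneg (Real.log_nonneg hY)
  have h7 : 0 ≤ n * Real.log (n / δ) := mul_nonneg n.cast_nonneg (log_div_nonneg hn hδ0 hδ1)
  have h8 : Real.log S + 2 ≤ (Real.log S + 2) / u * complexity n d ε δ := by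
    rw [div_mul_eq_mul_div, le_div_iff₀ hu]
    have := Real.log_nonneg hS
    gcongr
  have h9 : k * (d * Real.log (d * n / ε)) ≤ k * complexity n d ε δ := by
    unfold complexity
    gcongr
    linarith
  have h10 : n * Real.log (n / δ) ≤ complexity n d ε δ := by
    unfold complexity
    linarith
  rw [add_mul, add_mul]
  linarith

lemma abs_coordinates_le (hn : 1 ≤ n) (hd : 1 ≤ d) (hε0 : 0 < ε) (hε1 : ε < 1) (i : Fin 4) :
    |(![((n : ℝ) / ε) ^ d, ε, (d : ℝ), (n : ℝ)] : Fin 4 → ℝ) i| ≤ (d * n / ε) ^ d := by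
  have hn' : (1 : ℝ) ≤ n := by exact_mod_cast hn
  have hd' : (1 : ℝ) ≤ d := by exact_mod_cast hd
  have hY := one_le_mul_div hn hd hε0 hε1
  have hYd : (d * n / ε : ℝ) ≤ (d * n / ε) ^ d := le_self_pow₀ hY (by omega)
  fin_cases i
  · simp only [Fin.zero_eta, Matrix.cons_val_zero]
    rw [abs_of_nonneg (by positivity)]
    gcongr
    nlinarith
  · simp only [Fin.mk_one, Matrix.cons_val_one, Matrix.cons_val_zero]
    rw [abs_of_pos hε0]
    linarith
  · simp only [Fin.reduceFinMk, Matrix.cons_val]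
    rw [abs_of_nonneg (by positivity)]
    refine le_trans ?_ hYd
    rw [le_div_iff₀ hε0]
    nlinarith [mul_le_mul_of_nonneg_left hε1.le (Nat.cast_nonneg (α := ℝ) d)]
  · simp only [Fin.reduceFinMk, Matrix.cons_val]
    rw [abs_of_nonneg (by positivity)]
    refine le_trans ?_ hYd
    rw [le_div_iff₀ hε0]
    nlinarith [mul_le_mul_of_nonneg_left hε1.le (Nat.cast_nonneg (α := ℝ) n)]

end Complexity

/-! ### Learning with a net -/

lemma support_map_val_subset {X : Type u} (H : Set (X → Bool)) (N : Finset (X → Bool))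
    (p : PMF N) : (p.map Subtype.val).support ⊆ H ∪ ↑N := by
  intro f hf
  rw [PMF.mem_support_map_iff] at hf
  obtain ⟨a, -, rfl⟩ := hf
  exact Or.inr a.2

theorem exists_learner_of_net {X : Type u} [MeasurableSpace X] {n : ℕ} [NeZero n]
    {ε δ γ : ℝ} {H : Set (X → Bool)} {N : Finset (X → Bool)} {g : Bool → Bool → ℝ}
    (hγ0 : 0 < γ) (hγ1 : γ < 1) (hε0 : 0 < ε) (hε1 : ε < 1) (hδ0 : 0 < δ) (hδ1 : δ < 1)
    (hH : H.Nonempty) (hHm : ∀ h ∈ H, Measurable h) (hNm : ∀ f ∈ N, Measurable f)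
    (hg : ∀ a b, g a b ∈ Set.Icc (0 : ℝ) 1) (hN : N.Nonempty) :
    ∃ A : Learner n X,
      (A.calls : ℝ) ≤ 129 / ((1 - γ) * ε) ^ 2 *
        (Real.log N.card + n * Real.log (3 * n / δ)) ∧
      (∀ w, (A.output w).support ⊆ H ∪ ↑N) ∧
      ∀ D : Fin n → Measure (Datum X), (∀ i, IsProbabilityMeasure (D i)) →
        IsNet D H (γ * ε) N →
        A.law D A.calls {w | ¬ IsEpsOptimal g D H ε (A.output w)} ≤ ENNReal.ofReal δ := by
  have : Nonempty N := hN.to_subtype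
  set κ := (1 - γ) * ε with hκ
  have hκ0 : 0 < κ := mul_pos (by linarith) hε0
  have hκ1 : κ ≤ 1 := by nlinarith
  have hn : (1 : ℝ) ≤ n := by exact_mod_cast NeZero.one_le
  set B := Real.log N.card + n * Real.log (3 * n / δ) with hB
  have hlogN : 0 ≤ Real.log N.card :=
    Real.log_nonneg (by exact_mod_cast Finset.card_pos.2 hN)
  -- `3n/δ ≥ 3 > e`. With `κ ≤ 1` this lets `B / κ ^ 2` absorb the rounding up in `T`, turning `128`
  -- into `129`.
  have hB1 : 1 ≤ B := by
    have h1 : 1 ≤ Real.log (3 * n / δ) := by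
      rw [Real.le_log_iff_exp_le (by positivity), le_div_iff₀ hδ0]
      nlinarith [Real.exp_one_lt_three, Real.exp_pos 1]
    nlinarith
  have hκ2 : 0 < κ ^ 2 := by positivity
  set T := ⌈128 * B / κ ^ 2⌉₊ with hT_def
  have hT : 0 < T := Nat.ceil_pos.2 (by positivity)
  have hT1 : 128 * B ≤ κ ^ 2 * T := by
    have := Nat.le_ceil (128 * B / κ ^ 2)
    rw [div_le_iff₀ hκ2] at this
    linarith
  have hT2 : (T : ℝ) ≤ 129 / κ ^ 2 * B := by
    have h1 := (Nat.ceil_lt_add_one (a := 128 * B / κ ^ 2) (by positivity)).le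
    have h2 : 1 ≤ B / κ ^ 2 := by
      rw [le_div_iff₀ hκ2]
      nlinarith [pow_le_one₀ (n := 2) hκ0.le hκ1]
    have h3 : 129 / κ ^ 2 * B = 128 * B / κ ^ 2 + B / κ ^ 2 := by ring
    linarith
  have hη : 0 < κ / 8 := by positivity
  have hβ : 0 < κ / (8 * n) := by positivity
  have hm : ∀ f : N, Measurable fun z : Datum X => g (f.1 z.1) z.2 :=
    fun f => measurable_loss g (hNm f f.2)
  have hℓ : ∀ (f : N) (z : Datum X), g (f.1 z.1) z.2 ∈ Set.Icc (0 : ℝ) 1 := fun _ _ => hg _ _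
  refine ⟨gameLearner Subtype.val hm hℓ hη hβ hT, hT2,
    fun w => support_map_val_subset H N _, fun D hD hnet => ?_⟩
  obtain ⟨f, hf⟩ := exists_mem_net_risk_le (by positivity) hH hHm hNm hg hnet
  refine le_trans (measure_mono fun w hw => ?_) (gameLearner_guarantee Subtype.val hm hℓ hκ0 hκ1
    hδ0 hδ1 hT hη hβ (by rwa [Fintype.card_coe]) D f hf)
  change ∃ j, _
  by_contra! hcon
  refine hw (ciSup_le fun j => ?_)
  have h1 : randRisk g (D j) ((averageWeights hℓ hη hβ hT w).map Subtype.val) ≤ _ :=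
    (randRisk_map_val (D j) N _).trans_le (hcon j)
  refine h1.trans (le_of_eq ?_)
  rw [hκ]
  ring

end CollabLearning

end

/-! ### The main theorem -/

open CollabLearning in
theorem mainTheorem8 (P : MvPolynomial (Fin 4) ℝ) (γ : ℝ) (hγ0 : 0 < γ) (hγ1 : γ < 1) :
    ∃ C : ℝ, 0 < C ∧
      ∀ (X : Type*) [MeasurableSpace X] (n d : ℕ) (ε δ : ℝ) (H : Set (X → Bool))
        (N : Finset (X → Bool)) (g : Bool → Bool → ℝ),
        1 ≤ n → 0 < ε → ε < 1 → 0 < δ → δ < 1 →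
        H.Nonempty → (∀ h ∈ H, Measurable h) → vcDim H = d →
        (∀ f ∈ N, Measurable f) →
        (N.card : ℝ) ≤ MvPolynomial.eval ![((n : ℝ) / ε) ^ d, ε, (d : ℝ), (n : ℝ)] P →
        (∀ a b, g a b ∈ Set.Icc (0 : ℝ) 1) →
        ∃ A : Learner n X,
          (A.calls : ℝ) ≤
            C * (1 / ε ^ 2) * (d * Real.log (d * n / ε) + n * Real.log (n / δ)) ∧
          (∀ w, (A.output w).support ⊆ H ∪ ↑N) ∧
          ∀ D : Fin n → MeasureTheory.Measure (Datum X),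
            (∀ i, MeasureTheory.IsProbabilityMeasure (D i)) →
            IsNet D H (γ * ε) N →
            A.law D A.calls {w | ¬ IsEpsOptimal g D H ε (A.output w)} ≤ ENNReal.ofReal δ := by
  obtain ⟨S, hS, k, hP⟩ := exists_abs_eval_le P
  set u := min (Real.log 2) ((1 - γ) / (S * 2 ^ k)) with hu_def
  have hγ : 0 < 1 - γ := by linarith
  have hu : 0 < u := lt_min (Real.log_pos (by norm_num)) (by positivity)
  have hlogS := Real.log_nonneg hS
  refine ⟨129 / (1 - γ) ^ 2 * (k + 3 + (Real.log S + 2) / u), by positivity, ?_⟩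
  intro X _ n d ε δ H N g hn hε0 hε1 hδ0 hδ1 hH hHm hvc hNm hcard hg
  have : NeZero n := ⟨by omega⟩
  change ∃ A : Learner n X, (A.calls : ℝ) ≤ _ * (1 / ε ^ 2) * complexity n d ε δ ∧ _
  have hU0 := complexity_nonneg (d := d) hn hε0 hε1 hδ0 hδ1
  -- A fixed answer costs no calls, so nonnegativity of the bound suffices. This disposes of all
  -- degenerate cases.
  have hconst : ∀ q : PMF (X → Bool), q.support ⊆ H ∪ ↑N →
      (∀ D : Fin n → MeasureTheory.Measure (Datum X),
        (∀ i, MeasureTheory.IsProbabilityMeasure (D i)) → IsNet D H (γ * ε) N →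
        IsEpsOptimal g D H ε q) → ∃ A : Learner n X,
      (A.calls : ℝ) ≤ 129 / (1 - γ) ^ 2 * (k + 3 + (Real.log S + 2) / u) * (1 / ε ^ 2) *
        complexity n d ε δ ∧ (∀ w, (A.output w).support ⊆ H ∪ ↑N) ∧
      ∀ D : Fin n → MeasureTheory.Measure (Datum X),
        (∀ i, MeasureTheory.IsProbabilityMeasure (D i)) → IsNet D H (γ * ε) N →
        A.law D A.calls {w | ¬ IsEpsOptimal g D H ε (A.output w)} ≤ ENNReal.ofReal δ := by
    intro q hq hopt
    refine ⟨constLearner X n q, ?_, fun _ => hq, fun D hD hnet => ?_⟩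
    · simp only [constLearner, Nat.cast_zero]
      positivity
    · have h : {w | ¬ IsEpsOptimal g D H ε ((constLearner X n q).output w)} = ∅ :=
        Set.eq_empty_of_forall_notMem fun w hw => hw (hopt D hD hnet)
      rw [h, MeasureTheory.measure_empty]
      exact zero_le
  obtain ⟨h₀, hh₀⟩ := id hH
  have hpure : (PMF.pure h₀).support ⊆ H ∪ ↑N := by
    rw [PMF.support_pure, Set.singleton_subset_iff]
    exact Or.inl hh₀
  rcases Nat.eq_zero_or_pos d with rfl | hd
  · exact hconst _ hpure fun D _ _ =>
      isEpsOptimal_pure_of_vcDim_eq_zero (by simpa using hvc) hh₀ hε0.le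
  -- The empty set is not a net of a nonempty class, so any output is acceptable.
  rcases N.eq_empty_or_nonempty with rfl | hN
  · refine hconst _ hpure fun D _ hnet => ?_
    obtain ⟨f, hf, -⟩ := hnet h₀ hh₀
    simp at hf
  have : Nonempty N := hN.to_subtype
  by_cases hε : 1 - (1 - γ) / N.card ≤ ε
  · exact hconst _ (support_map_val_subset H N _) fun D hD hnet =>
      isEpsOptimal_uniform hγ0 hε0 hε1.le hH hHm hNm hg hnet hε
  obtain ⟨A, hA, hA'⟩ := exists_learner_of_net (n := n) (δ := δ) hγ0 hγ1 hε0 hε1 hδ0 hδ1 hH hHm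
    hNm hg hN
  refine ⟨A, hA.trans ?_, hA'⟩
  have hm : (N.card : ℝ) ≤ S * ((d * n / ε) ^ d) ^ k :=
    (hcard.trans (le_abs_self _)).trans (hP _ _ (one_le_pow₀ (one_le_mul_div hn hd hε0 hε1))
      (abs_coordinates_le hn hd hε0 hε1))
  have hm1 : (1 : ℝ) ≤ N.card := by exact_mod_cast Finset.card_pos.2 hN
  have h1 := log_add_le_complexity hn hd hε0 hε1 hδ0 hδ1 hm1 hm hS hu
    (complexity_lower_bound hγ1 hn hd hε0 hε1 hδ0 hδ1 hm1 hm (not_le.1 hε).le hS)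
  calc _ ≤ 129 / ((1 - γ) * ε) ^ 2 *
        ((k + 3 + (Real.log S + 2) / u) * complexity n d ε δ) := by gcongr
    _ = _ := by
        rw [mul_pow]
        field_simp
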